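/- All graphs are finite and simple. A graph is *$P_4$-sparse* if every set of at most five of its vertices induces at most one $P_4$ (the path on four vertices). A graph $G$ is *polar* if $V(G)$ has a partition $(A,B)$, with $A$ or $B$ possibly empty, such that $G[A]$ is a complete multipartite graph and $G[B]$ is a cluster, that is, the complement of a complete multipartite graph (with no bound on the numbers of parts). A *minimal polar obstruction* is a graph that is not polar but all of whose proper induced subgraphs are polar. A *cograph* is a graph that can be constructed from one-vertex graphs by means of disjoint unions and complements. **Theorem.** If $G$ is a $P_4$-sparse minimal polar obstruction, then $G$ is a cograph. -/

import Mathlib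

universe u

namespace SimpleGraph

/-- A graph is `P₄`-sparse if every set of at most five vertices induces at most one path on four
vertices (induced paths are identified with their vertex sets). -/
def IsP4Sparse {V : Type u} (G : SimpleGraph V) : Prop :=
  ∀ W : Finset V, W.card ≤ 5 →
    ∀ S T : Finset V, S ⊆ W → T ⊆ W →
      Nonempty (pathGraph 4 ≃g G.induce (S : Set V)) →
      Nonempty (pathGraph 4 ≃g G.induce (T : Set V)) → S = T

/-- A cluster is the complement of a complete multipartite graph. -/
def IsCluster {V : Type u} (G : SimpleGraph V) : Prop :=
  Gᶜ.IsCompleteMultipartite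

/-- A graph is polar if its vertex set has a partition `(A, B)`, where `A` or `B` may be empty,
such that `A` induces a complete multipartite graph and `B` induces a cluster, with no bound on
the number of parts. -/
def IsPolar {V : Type u} (G : SimpleGraph V) : Prop :=
  ∃ A B : Set V, IsCompl A B ∧
    (G.induce A).IsCompleteMultipartite ∧ (G.induce B).IsCluster

/-- A minimal polar obstruction is a graph that is not polar, all of whose proper induced
subgraphs are polar. -/
def IsMinimalPolarObstruction {V : Type u} (G : SimpleGraph V) : Prop :=
  ¬ G.IsPolar ∧ ∀ S : Set V, S ≠ Set.univ → (G.induce S).IsPolar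

/-- A cograph is a graph that can be constructed, up to isomorphism, from one-vertex graphs by
means of disjoint unions and complements. -/
inductive IsCograph : ∀ {V : Type u}, SimpleGraph V → Prop
  | trivial {V : Type u} [Unique V] (G : SimpleGraph V) : IsCograph G
  | sum {V W : Type u} {G : SimpleGraph V} {H : SimpleGraph W} :
      IsCograph G → IsCograph H → IsCograph (G ⊕g H)
  | compl {V : Type u} {G : SimpleGraph V} : IsCograph G → IsCograph Gᶜ
  | iso {V W : Type u} {G : SimpleGraph V} {H : SimpleGraph W} :
      G ≃g H → IsCograph G → IsCograph H

end SimpleGraph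

/-! Suppose the graph is not a cograph; by Seinsche's theorem (`hasP4_of_not_isSeparated`) it
contains an induced `P₄`. A connected and co-connected `P₄`-sparse graph is a spider
(`HasSparseP4.exists_isSpider`). Minimality makes the head polar, and a polar partition of the head
extends to the spider: the body joins the multipartite side, the legs join the cluster
(`IsSpider.isPolarOn`). So the graph or its complement is disconnected, and as all hypotheses are
self-complementary it may be taken to be the graph.

For a separation into `X` and `Y` it suffices that both sides are monopolar, for then so is the
union. If `X` is not monopolar, then `Y` is not a cluster, hence contains a `P₃`. A non-monopolar
set with a `P₃` far from it is never polar, so by minimality the graph is exactly `X` plus that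
`P₃`, and `X` is a minimal non-monopolar set containing the `P₄`. No such set exists
(`HasSparseP4.isMonopolarOn_of_minimal`); its co-disconnected case reduces to minimal sets that are
neither split nor clusters (`HasSparseP4.isSplitOn_of_minimal`). -/

namespace SimpleGraph

variable {V : Type u} {G : SimpleGraph V} {A B M U W X Y Z : Set V} {a b c d m v w y z : V}

/-! ### Induced paths, separations and Seinsche's theorem -/

/-- The vertices `a, b, c, d` form, in this order, an induced path. -/
def IsP4 (G : SimpleGraph V) (a b c d : V) : Prop :=
  G.Adj a b ∧ G.Adj b c ∧ G.Adj c d ∧ ¬G.Adj a c ∧ ¬G.Adj b d ∧ ¬G.Adj a d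

/-- The set `U` contains an induced path on four vertices. -/
def HasP4 (G : SimpleGraph V) (U : Set V) : Prop :=
  ∃ a ∈ U, ∃ b ∈ U, ∃ c ∈ U, ∃ d ∈ U, G.IsP4 a b c d

lemma IsP4.ne (h : G.IsP4 a b c d) : a ≠ b ∧ a ≠ c ∧ a ≠ d ∧ b ≠ c ∧ b ≠ d ∧ c ≠ d := by
  obtain ⟨h1, h2, h3, h4, h5, h6⟩ := h
  refine ⟨h1.ne, ?_, ?_, h2.ne, ?_, h3.ne⟩ <;> rintro rfl
  · exact h6 h3
  · exact h5 h1.symm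
  · exact h6 h1

/-- `P₄` is self-complementary; complementing turns the ends into the midpoints. -/
lemma IsP4.compl (h : G.IsP4 a b c d) : Gᶜ.IsP4 b d a c := by
  obtain ⟨n1, n2, n3, n4, n5, n6⟩ := h.ne
  obtain ⟨h1, h2, h3, h4, h5, h6⟩ := h
  simp only [IsP4, compl_adj, G.adj_comm b a, G.adj_comm d a, G.adj_comm d c]
  tauto

lemma HasP4.compl (h : G.HasP4 U) : Gᶜ.HasP4 U := by
  obtain ⟨a, ha, b, hb, c, hc, d, hd, h⟩ := h
  exact ⟨b, hb, d, hd, a, ha, c, hc, h.compl⟩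

lemma hasP4_compl : Gᶜ.HasP4 U ↔ G.HasP4 U :=
  ⟨fun h => by simpa using h.compl, HasP4.compl⟩

lemma HasP4.mono {W : Set V} (h : G.HasP4 U) (hUW : U ⊆ W) : G.HasP4 W := by
  obtain ⟨a, ha, b, hb, c, hc, d, hd, h⟩ := h
  exact ⟨a, hUW ha, b, hUW hb, c, hUW hc, d, hUW hd, h⟩

/-- The set `U` splits into two nonempty parts without edges between them. -/
def IsSeparated (G : SimpleGraph V) (U : Set V) : Prop :=
  ∃ X Y : Set V, X.Nonempty ∧ Y.Nonempty ∧ Disjoint X Y ∧ X ∪ Y = U ∧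
    ∀ x ∈ X, ∀ y ∈ Y, ¬G.Adj x y

lemma exists_adj_of_not_isSeparated (h : ¬G.IsSeparated U) {X : Set V} (hXU : X ⊆ U)
    (hX : X.Nonempty) (hvU : v ∈ U) (hvX : v ∉ X) :
    ∃ x ∈ X, ∃ y ∈ U, y ∉ X ∧ G.Adj x y := by
  by_contra! hc
  exact h ⟨X, U \ X, hX, ⟨v, hvU, hvX⟩, Set.disjoint_sdiff_right, Set.union_sdiff_cancel hXU,
    fun x hx y hy => hc x hx y hy.1 hy.2⟩

/-- An induced path lies on one side of a separation. -/
lemma HasP4.of_union {X Y : Set V} (hXY : ∀ x ∈ X, ∀ y ∈ Y, ¬G.Adj x y)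
    (h : G.HasP4 (X ∪ Y)) : G.HasP4 X ∨ G.HasP4 Y := by
  obtain ⟨a, ha, b, hb, c, hc, d, hd, h⟩ := h
  have key : ∀ {x y}, G.Adj x y → x ∈ X ∪ Y → y ∈ X ∪ Y → (x ∈ X → y ∈ X) ∧ (x ∈ Y → y ∈ Y) := by
    rintro x y hxy hx hy
    exact ⟨fun h => hy.resolve_right fun h' => hXY x h y h' hxy,
      fun h => hy.resolve_left fun h' => hXY y h' x h hxy.symm⟩
  have h1 := key h.1 ha hb
  have h2 := key h.2.1 hb hc
  have h3 := key h.2.2.1 hc hd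
  rcases ha with ha | ha
  · exact Or.inl ⟨a, ha, b, h1.1 ha, c, h2.1 (h1.1 ha), d, h3.1 (h2.1 (h1.1 ha)), h⟩
  · exact Or.inr ⟨a, ha, b, h1.2 ha, c, h2.2 (h1.2 ha), d, h3.2 (h2.2 (h1.2 ha)), h⟩

/-- Inductive step for Seinsche's theorem, with `v` a cut vertex. Co-connectedness gives a
non-neighbour of `v`, say in `X`. By connectedness an edge leads from the non-neighbours of `v` in
`X` to a neighbour of `v` in `X`; it extends through `v` into `Y` to an induced `P₄`. -/
lemma hasP4_of_isSeparated_diff (hvU : v ∈ U) (hU : ¬G.IsSeparated U) (hU' : ¬Gᶜ.IsSeparated U)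
    (h : G.IsSeparated (U \ {v})) : G.HasP4 U := by
  obtain ⟨X, Y, hX, hY, hdis, hXYU, hXY⟩ := h
  have hmem : ∀ x, x ∈ U ↔ x = v ∨ x ∈ X ∨ x ∈ Y := by
    intro x
    have := Set.ext_iff.1 hXYU x
    simp only [Set.mem_union, Set.mem_sdiff, Set.mem_singleton_iff] at this
    by_cases hx : x = v
    · simp [hx, hvU]
    · tauto
  have hv : v ∉ X ∧ v ∉ Y := by
    have := Set.ext_iff.1 hXYU v
    simpa using this
  obtain ⟨x₀, hx₀⟩ := hX
  obtain ⟨v', rfl, w, hwU, hwv, hvw⟩ := exists_adj_of_not_isSeparated hU' (X := {v})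
    (by simpa using hvU) (by simp) ((hmem x₀).2 (by tauto)) (by rintro rfl; exact hv.1 hx₀)
  have hvw' : ¬G.Adj v' w := fun h => hvw.2 h
  have main : ∀ X Y : Set V, Y.Nonempty → (∀ x ∈ X, ∀ y ∈ Y, ¬G.Adj x y) →
      (∀ x, x ∈ U ↔ x = v' ∨ x ∈ X ∨ x ∈ Y) → v' ∉ X → v' ∉ Y → w ∈ X → G.HasP4 U := by
    clear! X Y
    intro X Y hY hXY hmem hvX hvY hwX
    obtain ⟨x', ⟨hx'X, hx'v⟩, x, hxU, hxn, hx'x⟩ := exists_adj_of_not_isSeparated hU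
      (X := {x | x ∈ X ∧ ¬G.Adj v' x}) (fun x hx => (hmem x).2 (Or.inr (Or.inl hx.1)))
      ⟨w, hwX, hvw'⟩ hvU (fun h => hvX h.1)
    have hxX : x ∈ X := by
      rcases (hmem x).1 hxU with rfl | h | h
      · exact absurd hx'x.symm hx'v
      · exact h
      · exact absurd hx'x (hXY _ hx'X _ h)
    have hvx : G.Adj v' x := by
      by_contra h
      exact hxn ⟨hxX, h⟩
    obtain ⟨y, hyY, z, hzU, hzY, hyz⟩ := exists_adj_of_not_isSeparated hU (X := Y)
      (fun y hy => (hmem y).2 (Or.inr (Or.inr hy))) hY hvU hvY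
    have hzv : z = v' := by
      rcases (hmem z).1 hzU with h | h | h
      · exact h
      · exact absurd hyz.symm (hXY _ h _ hyY)
      · exact absurd h hzY
    subst hzv
    exact ⟨x', (hmem _).2 (by tauto), x, hxU, z, hvU, y, (hmem _).2 (by tauto), hx'x, hvx.symm,
      hyz.symm, fun h => hx'v h.symm, hXY _ hxX _ hyY, hXY _ hx'X _ hyY⟩
  rcases (hmem w).1 hwU with rfl | h | h
  · exact absurd rfl hwv
  · exact main X Y hY hXY hmem hv.1 hv.2 h
  · exact main Y X ⟨x₀, hx₀⟩ (fun x hx y hy hh => hXY y hy x hx hh.symm)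
      (fun x => by rw [hmem x, or_comm (a := x ∈ X)]) hv.2 hv.1 h

/-- Seinsche's theorem: a set of at least two vertices without induced `P₄` induces a
disconnected graph or the complement of one. -/
theorem hasP4_of_not_isSeparated [Finite V] (hU : U.Nontrivial) (h : ¬G.IsSeparated U)
    (h' : ¬Gᶜ.IsSeparated U) : G.HasP4 U := by
  induction hn : U.ncard using Nat.strong_induction_on generalizing U with
  | _ n ih =>
  obtain ⟨v, hv, w, hw, hvw⟩ := hU
  by_cases hs : G.IsSeparated (U \ {v})
  · exact hasP4_of_isSeparated_diff hv h h' hs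
  by_cases hs' : Gᶜ.IsSeparated (U \ {v})
  · exact hasP4_compl.1 (hasP4_of_isSeparated_diff hv h' (by simpa using h) hs')
  by_cases hnt : (U \ {v}).Nontrivial
  · exact (ih _ (hn ▸ Set.ncard_sdiff_singleton_lt_of_mem hv) hnt hs hs' rfl).mono Set.sdiff_subset
  · have hU : ∀ x ∈ U, x = v ∨ x = w := by
      intro x hx
      by_contra! hc
      exact hnt ⟨x, ⟨hx, hc.1⟩, w, ⟨hw, hvw.symm⟩, hc.2⟩
    have hU' : ({v} ∪ {w} : Set V) = U := by
      ext x
      simp only [Set.mem_union, Set.mem_singleton_iff]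
      exact ⟨by rintro (rfl | rfl) <;> assumption, hU x⟩
    by_cases hadj : G.Adj v w
    · exact absurd ⟨{v}, {w}, by simp, by simp, by simpa using hvw, hU', by simp [hadj]⟩ h'
    · exact absurd ⟨{v}, {w}, by simp, by simp, by simpa using hvw, hU', by simp [hadj]⟩ h

/-! ### Cographs from the absence of `P₄` -/

/-- An edgeless partition presents an induced subgraph as a disjoint union. -/
noncomputable def induceUnionIso {X Y : Set V} (hdis : Disjoint X Y)
    (hXY : ∀ x ∈ X, ∀ y ∈ Y, ¬G.Adj x y) :
    (G.induce X ⊕g G.induce Y) ≃g G.induce (X ∪ Y) := by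
  classical
  exact
  { toEquiv := (Equiv.Set.union hdis).symm
    map_rel_iff' := by
      rintro (⟨x, hx⟩ | ⟨x, hx⟩) (⟨y, hy⟩ | ⟨y, hy⟩)
      · simp
      · simpa using hXY x hx y hy
      · simpa using fun h : G.Adj x y => hXY y hy x hx h.symm
      · simp }

lemma induce_compl (U : Set V) : Gᶜ.induce U = (G.induce U)ᶜ := by
  ext x y
  simp [Subtype.ext_iff]

theorem isCograph_induce_of_not_hasP4 [Finite V] {G : SimpleGraph V} (hU : U.Nonempty)
    (h : ¬G.HasP4 U) : (G.induce U).IsCograph := by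
  induction hn : U.ncard using Nat.strong_induction_on generalizing U G with
  | _ n ih =>
  have main : ∀ H : SimpleGraph V, ¬H.HasP4 U → H.IsSeparated U → (H.induce U).IsCograph := by
    rintro H hH ⟨X, Y, hX, hY, hdis, rfl, hXY⟩
    have hXn : X.ncard < n := by
      rw [← hn, Set.ncard_union_eq hdis]
      have := (Set.ncard_pos (s := Y)).2 hY
      omega
    have hYn : Y.ncard < n := by
      rw [← hn, Set.ncard_union_eq hdis]
      have := (Set.ncard_pos (s := X)).2 hX
      omega
    exact (((ih _ hXn hX (fun h => hH (h.mono Set.subset_union_left)) rfl).sum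
      (ih _ hYn hY (fun h => hH (h.mono Set.subset_union_right)) rfl))).iso
        (induceUnionIso hdis hXY)
  by_cases hnt : U.Nontrivial
  · by_cases hs : G.IsSeparated U
    · exact main G h hs
    by_cases hs' : Gᶜ.IsSeparated U
    · have := (main Gᶜ (fun hc => h (hasP4_compl.1 hc)) hs').compl
      rwa [induce_compl, compl_compl] at this
    exact absurd (hasP4_of_not_isSeparated hnt hs hs') h
  · obtain ⟨x, rfl⟩ := hU.exists_eq_singleton_or_nontrivial.resolve_right hnt
    exact IsCograph.trivial _

theorem isCograph_of_not_hasP4 [Finite V] [Nonempty V] (h : ¬G.HasP4 Set.univ) : G.IsCograph :=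
  (isCograph_induce_of_not_hasP4 Set.univ_nonempty h).iso G.induceUnivIso

/-! ### The local form of `P₄`-sparseness -/

/-- Every further vertex sees nothing, the two midpoints, or everything of an induced `P₄`. -/
def HasSparseP4 (G : SimpleGraph V) : Prop :=
  ∀ ⦃a b c d v : V⦄, G.IsP4 a b c d → v ≠ a → v ≠ b → v ≠ c → v ≠ d →
    (¬G.Adj v a ∧ ¬G.Adj v b ∧ ¬G.Adj v c ∧ ¬G.Adj v d) ∨
    (¬G.Adj v a ∧ G.Adj v b ∧ G.Adj v c ∧ ¬G.Adj v d) ∨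
    (G.Adj v a ∧ G.Adj v b ∧ G.Adj v c ∧ G.Adj v d)

lemma HasSparseP4.compl (h : G.HasSparseP4) : Gᶜ.HasSparseP4 := by
  intro a b c d v hP ha hb hc hd
  have hP' : G.IsP4 b d a c := by simpa using hP.compl
  have := h hP' hb hd ha hc
  simp only [compl_adj]
  tauto

lemma IsP4.nonempty_iso [DecidableEq V] (h : G.IsP4 a b c d) :
    Nonempty (pathGraph 4 ≃g G.induce ((({a, b, c, d} : Finset V)) : Set V)) := by
  obtain ⟨n1, n2, n3, n4, n5, n6⟩ := h.ne
  obtain ⟨h1, h2, h3, h4, h5, h6⟩ := h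
  let f : Fin 4 → ((({a, b, c, d} : Finset V)) : Set V) :=
    ![⟨a, by simp⟩, ⟨b, by simp⟩, ⟨c, by simp⟩, ⟨d, by simp⟩]
  have hf : f.Bijective := by
    constructor
    · intro i j hij
      fin_cases i <;> fin_cases j <;> simp_all [f]
    · rintro ⟨x, hx⟩
      simp only [Finset.coe_insert, Finset.coe_singleton, Set.mem_insert_iff,
        Set.mem_singleton_iff] at hx
      rcases hx with rfl | rfl | rfl | rfl
      exacts [⟨0, rfl⟩, ⟨1, rfl⟩, ⟨2, rfl⟩, ⟨3, rfl⟩]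
  refine ⟨⟨Equiv.ofBijective f hf, ?_⟩⟩
  intro i j
  fin_cases i <;> fin_cases j <;> simp_all [f, pathGraph_adj, G.adj_comm]

lemma IsP4Sparse.hasSparseP4 (h : G.IsP4Sparse) : G.HasSparseP4 := by
  classical
  intro a b c d v hP va vb vc vd
  have key : ∀ {a' b' c' d' : V}, a' ∈ ({a, b, c, d, v} : Finset V) →
      b' ∈ ({a, b, c, d, v} : Finset V) → c' ∈ ({a, b, c, d, v} : Finset V) →
      d' ∈ ({a, b, c, d, v} : Finset V) → G.IsP4 a' b' c' d' →
      v ≠ a' ∧ v ≠ b' ∧ v ≠ c' ∧ v ≠ d' := by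
    intro a' b' c' d' ha hb hc hd hP'
    have := h {a, b, c, d, v} Finset.card_le_five {a, b, c, d} {a', b', c', d'}
      (by intro x; simp; tauto)
      (by
        intro x hx
        simp only [Finset.mem_insert, Finset.mem_singleton] at hx
        rcases hx with rfl | rfl | rfl | rfl <;> assumption)
      hP.nonempty_iso hP'.nonempty_iso
    have hv : v ∉ ({a, b, c, d} : Finset V) := by simp; tauto
    rw [this] at hv
    simpa using hv
  obtain ⟨h1, h2, h3, h4, h5, h6⟩ := hP
  have s1 := h1.symm
  have s3 := h3.symm
  have t5 : ¬G.Adj d b := fun h => h5 h.symm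
  have t6 : ¬G.Adj d a := fun h => h6 h.symm
  have k : ∀ p q r s : V, p ∈ ({a, b, c, d, v} : Finset V) ∧ q ∈ ({a, b, c, d, v} : Finset V) ∧
      r ∈ ({a, b, c, d, v} : Finset V) ∧ s ∈ ({a, b, c, d, v} : Finset V) ∧
      (v = p ∨ v = q ∨ v = r ∨ v = s) → ¬G.IsP4 p q r s := by
    rintro p q r s ⟨hp, hq, hr, hs, hv⟩ hP
    have := key hp hq hr hs hP
    tauto
  -- Each of the 13 forbidden neighbourhoods of `v` on the path creates one of these eight paths
  -- through `v`, a second `P₄` on the five vertices.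
  have e1 := k v a b c (by simp)
  have e2 := k v b c d (by simp)
  have e3 := k a v c d (by simp)
  have e4 := k a b v d (by simp)
  have e5 := k a b c v (by simp)
  have e6 := k b c d v (by simp)
  have e7 := k b a v d (by simp)
  have e8 := k a v d c (by simp)
  simp only [IsP4, h1, h2, h3, h4, h5, h6, s1, s3, G.adj_comm a v, G.adj_comm b v,
    G.adj_comm c v, G.adj_comm d v] at e1 e2 e3 e4 e5 e6 e7 e8
  clear h key k
  by_cases va' : G.Adj v a <;> by_cases vb' : G.Adj v b <;> by_cases vc' : G.Adj v c <;>
    by_cases vd' : G.Adj v d <;> simp_all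

/-! ### Spiders and maximal indexed spiders -/

/-- The set `U` induces a spider with legs `S` and body `K`; its head is the rest of `U`. Instead
of fixing a matching between `S` and `K`, we only record that their vertices lie on induced
`P₄`s. -/
structure IsSpider (G : SimpleGraph V) (U S K : Set V) : Prop where
  disjoint : Disjoint S K
  legs_subset : S ⊆ U
  body_subset : K ⊆ U
  legs_nonempty : S.Nonempty
  body_nontrivial : K.Nontrivial
  isIndepSet : G.IsIndepSet S
  isClique : G.IsClique K
  adj_head : ∀ k ∈ K, ∀ r ∈ U, r ∉ S → r ∉ K → G.Adj k r
  not_adj_head : ∀ s ∈ S, ∀ r ∈ U, r ∉ S → r ∉ K → ¬G.Adj s r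
  exists_isP4_leg : ∀ s ∈ S, ∃ b ∈ U, ∃ c ∈ U, ∃ d ∈ U, G.IsP4 s b c d
  exists_isP4_body : ∀ k ∈ K, ∃ a ∈ U, ∃ c ∈ U, ∃ d ∈ U, G.IsP4 a k c d

/-- An indexed spider without head; leg `s i` is joined either to `k i` only (thin) or to all
other `k j` (thick). -/
structure IsIndexedSpider (G : SimpleGraph V) (U : Set V) (thin : Prop) {n : ℕ} (s k : Fin n → V) :
    Prop where
  mem_leg : ∀ i, s i ∈ U
  mem_body : ∀ i, k i ∈ U
  adj_body : ∀ i j, i ≠ j → G.Adj (k i) (k j)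
  not_adj_leg : ∀ i j, ¬G.Adj (s i) (s j)
  adj_iff : ∀ i j, G.Adj (s i) (k j) ↔ (i = j ↔ thin)

namespace IsIndexedSpider

variable {thin : Prop} {n : ℕ} {s k : Fin n → V}

lemma body_ne (h : G.IsIndexedSpider U thin s k) {i j : Fin n} (hij : i ≠ j) : k i ≠ k j :=
  (h.adj_body i j hij).ne

lemma le_card [Finite V] (h : G.IsIndexedSpider U thin s k) : n ≤ Nat.card V := by
  have hinj : Function.Injective k := by
    intro i j hij
    by_contra hne
    exact h.body_ne hne hij
  simpa using Nat.card_le_card_of_injective k hinj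

lemma exists_ne_of_two_le (hn : 2 ≤ n) (i : Fin n) : ∃ j, j ≠ i := by
  by_cases h : i.val = 0
  · exact ⟨⟨1, hn⟩, fun h' => by simp [← h'] at h⟩
  · exact ⟨⟨0, by omega⟩, fun h' => h (by simp [← h'])⟩

lemma leg_ne (h : G.IsIndexedSpider U thin s k) {i j : Fin n} (hij : i ≠ j) : s i ≠ s j := by
  intro he
  have h1 := h.adj_iff i i
  have h2 := h.adj_iff j i
  rw [← he] at h2
  have := h1.symm.trans h2
  simp only [hij.symm] at this
  tauto

lemma leg_ne_body (h : G.IsIndexedSpider U thin s k) (hn : 2 ≤ n) (i j : Fin n) : s i ≠ k j := by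
  intro he
  by_cases ht : thin
  · exact h.not_adj_leg j i (he ▸ (h.adj_iff j j).2 (by simp [ht]))
  · obtain ⟨l, hl⟩ := exists_ne_of_two_le hn j
    exact h.not_adj_leg l i (he ▸ (h.adj_iff l j).2 (by simp [ht, hl]))

/-- Complementing exchanges legs with body and thin with thick. With `n = 1`, a thick spider could
have its leg equal to its body vertex. -/
lemma compl (h : G.IsIndexedSpider U thin s k) (hn : 2 ≤ n) :
    Gᶜ.IsIndexedSpider U (¬thin) k s where
  mem_leg := h.mem_body
  mem_body := h.mem_leg
  adj_body i j hij := ⟨h.leg_ne hij, h.not_adj_leg i j⟩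
  not_adj_leg i j hc := by
    by_cases hij : i = j
    · exact hc.ne (by rw [hij])
    · exact hc.2 (h.adj_body i j hij)
  adj_iff i j := by
    have := h.adj_iff j i
    rw [compl_adj, G.adj_comm, this, eq_comm (a := j)]
    simp only [(h.leg_ne_body hn j i).symm, ne_eq, not_false_eq_true, true_and]
    tauto

/-- A spider with two legs is just a `P₄`, so it is both thin and thick, depending on how the legs
are matched to the body. -/
lemma rev {s k : Fin 2 → V} (h : G.IsIndexedSpider U thin s k) :
    G.IsIndexedSpider U (¬thin) (fun i => s i.rev) k where
  mem_leg i := h.mem_leg _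
  mem_body := h.mem_body
  adj_body := h.adj_body
  not_adj_leg i j := h.not_adj_leg _ _
  adj_iff i j := by
    rw [h.adj_iff]
    have : i.rev = j ↔ ¬ i = j := by
      revert i j
      decide
    rw [this]
    tauto

lemma isP4_thin (h : G.IsIndexedSpider U thin s k) (ht : thin) {i j : Fin n} (hij : i ≠ j) :
    G.IsP4 (s i) (k i) (k j) (s j) := by
  refine ⟨(h.adj_iff i i).2 (by simp [ht]), h.adj_body i j hij,
    ((h.adj_iff j j).2 (by simp [ht])).symm, fun hc => ?_, fun hc => ?_, h.not_adj_leg i j⟩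
  · exact hij (((h.adj_iff i j).1 hc).2 ht)
  · exact hij.symm (((h.adj_iff j i).1 hc.symm).2 ht)

lemma isP4_thick (h : G.IsIndexedSpider U thin s k) (ht : ¬thin) {i j : Fin n} (hij : i ≠ j) :
    G.IsP4 (s i) (k j) (k i) (s j) := by
  refine ⟨(h.adj_iff i j).2 (by simp [ht, hij]), h.adj_body j i hij.symm,
    ((h.adj_iff j i).2 (by simp [ht, hij.symm])).symm, fun hc => ?_, fun hc => ?_,
    h.not_adj_leg i j⟩
  · exact ht (((h.adj_iff i i).1 hc).1 rfl)
  · exact ht (((h.adj_iff j j).1 hc.symm).1 rfl)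

/-- Any two indices span a `P₄` with midpoints in the body, to which the trichotomy applies;
comparing every index with `0` makes the answer uniform. -/
lemma adj_cases (h : G.IsIndexedSpider U thin s k) (hG : G.HasSparseP4) (hn : 2 ≤ n)
    (hs : ∀ i, v ≠ s i) (hk : ∀ i, v ≠ k i) :
    (∀ i, ¬G.Adj v (s i) ∧ ¬G.Adj v (k i)) ∨ (∀ i, ¬G.Adj v (s i) ∧ G.Adj v (k i)) ∨
      ∀ i, G.Adj v (s i) ∧ G.Adj v (k i) := by
  have key : ∀ i j, i ≠ j →
      (¬G.Adj v (s i) ∧ ¬G.Adj v (k i) ∧ ¬G.Adj v (k j) ∧ ¬G.Adj v (s j)) ∨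
      (¬G.Adj v (s i) ∧ G.Adj v (k i) ∧ G.Adj v (k j) ∧ ¬G.Adj v (s j)) ∨
      (G.Adj v (s i) ∧ G.Adj v (k i) ∧ G.Adj v (k j) ∧ G.Adj v (s j)) := by
    intro i j hij
    by_cases ht : thin
    · exact hG (h.isP4_thin ht hij) (hs i) (hk i) (hk j) (hs j)
    · have := hG (h.isP4_thick ht hij) (hs i) (hk j) (hk i) (hs j)
      tauto
  let o : Fin n := ⟨0, by omega⟩
  obtain ⟨l, hl⟩ := exists_ne_of_two_le hn o
  have all : ∀ i, (G.Adj v (s i) ↔ G.Adj v (s o)) ∧ (G.Adj v (k i) ↔ G.Adj v (k o)) := by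
    intro i
    by_cases hi : i = o
    · simp [hi]
    · have := key i o hi
      tauto
  have ho := key l o hl
  have h1 := all l
  simp only [fun i => (all i).1, fun i => (all i).2]
  have : Nonempty (Fin n) := ⟨o⟩
  simp only [forall_const]
  tauto

lemma cons (h : G.IsIndexedSpider U thin s k) (ht : thin) (hvU : v ∈ U) (hwU : w ∈ U)
    (hv : ∀ i, ¬G.Adj v (s i) ∧ G.Adj v (k i)) (hw : ∀ i, ¬G.Adj w (s i) ∧ ¬G.Adj w (k i))
    (hvw : G.Adj v w) :
    G.IsIndexedSpider U thin (Fin.cons w s : Fin (n + 1) → V) (Fin.cons v k : Fin (n + 1) → V) where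
  mem_leg := Fin.cases hwU h.mem_leg
  mem_body := Fin.cases hvU h.mem_body
  adj_body i j := by
    cases i using Fin.cases <;> cases j using Fin.cases
    · simp
    · simpa using fun _ => (hv _).2
    · rename_i i
      simpa using (hv i).2.symm
    · simpa using h.adj_body _ _
  not_adj_leg i j := by
    cases i using Fin.cases <;> cases j using Fin.cases
    · simp
    · simpa using (hw _).1
    · simpa using fun hc : G.Adj (s _) w => (hw _).1 hc.symm
    · simpa using h.not_adj_leg _ _
  adj_iff i j := by
    cases i using Fin.cases <;> cases j using Fin.cases
    · simpa [ht] using hvw.symm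
    · rename_i j
      simpa [ht, (Fin.succ_ne_zero j).symm] using (hw j).2
    · rename_i i
      simpa [ht] using fun hc : G.Adj (s i) v => (hv i).1 hc.symm
    · simpa using h.adj_iff _ _

/-- If `v` and `w` were adjacent, a thin spider would grow by the body vertex `v` and the leg `w`,
and a thick one with two legs is thin after `rev`. -/
lemma not_adj_of_maximal (h : G.IsIndexedSpider U thin s k) (hG : G.HasSparseP4) (hn : 2 ≤ n)
    (hmax : ∀ (thin' : Prop) (s' k' : Fin (n + 1) → V), ¬G.IsIndexedSpider U thin' s' k')
    (hvU : v ∈ U) (hwU : w ∈ U) (hv : ∀ i, ¬G.Adj v (s i) ∧ G.Adj v (k i))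
    (hw : ∀ i, ¬G.Adj w (s i) ∧ ¬G.Adj w (k i)) : ¬G.Adj v w := by
  intro hvw
  by_cases ht : thin
  · exact hmax _ _ _ (h.cons ht hvU hwU hv hw hvw)
  obtain rfl | hn : n = 2 ∨ 3 ≤ n := by omega
  · exact hmax _ _ _ (h.rev.cons ht hvU hwU (fun i => ⟨(hv _).1, (hv i).2⟩)
      (fun i => ⟨(hw _).1, (hw i).2⟩) hvw)
  · let i : Fin n := ⟨0, by omega⟩
    let j : Fin n := ⟨1, by omega⟩
    let l : Fin n := ⟨2, by omega⟩
    have hij : i ≠ j := by simp [i, j]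
    have hil : i ≠ l := by simp [i, l]
    have hlj : l ≠ j := by simp [l, j]
    -- In a thick spider with three legs, `k l` sees the end `s i` of this path but not the end `w`,
    -- which sparseness forbids.
    have hP : G.IsP4 (s i) (k j) v w :=
      ⟨(h.adj_iff i j).2 (by simp [hij, ht]), (hv j).2.symm, hvw, fun hc => (hv i).1 hc.symm,
        fun hc => (hw j).2 hc.symm, fun hc => (hw i).1 hc.symm⟩
    have hls : G.Adj (k l) (s i) := ((h.adj_iff i l).2 (by simp [hil, ht])).symm
    have hlw : ¬G.Adj (k l) w := fun hc => (hw l).2 hc.symm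
    have := hG hP hls.ne (h.body_ne hlj) (hv l).2.ne' (fun he => (hw l).2 (by
      exact absurd (he ▸ hls) (hw i).1))
    tauto

end IsIndexedSpider

/-! ### Modules and quotients -/

/-- Every outside vertex of `U` is joined to all or to no vertices of the module `M`. -/
def IsModuleIn (G : SimpleGraph V) (U M : Set V) : Prop :=
  ∀ v ∈ U, v ∉ M → (∀ x ∈ M, ¬G.Adj v x) ∨ ∀ x ∈ M, G.Adj v x

lemma IsModuleIn.compl (h : G.IsModuleIn U M) : Gᶜ.IsModuleIn U M := by
  intro v hv hvM
  rcases h v hv hvM with h | h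
  · exact Or.inr fun x hx => ⟨by rintro rfl; exact hvM hx, h x hx⟩
  · exact Or.inl fun x hx hc => hc.2 (h x hx)

/-- The side of the separation that contains `m` absorbs all of `M`. Thus contracting a module keeps
connectedness. -/
lemma IsModuleIn.isSeparated (h : G.IsModuleIn U M) (hMU : M ⊆ U) (hm : m ∈ M)
    (hs : G.IsSeparated (insert m (U \ M))) : G.IsSeparated U := by
  obtain ⟨X, Y, hX, hY, hdis, hXYU, hXY⟩ := hs
  have main : ∀ X Y : Set V, Y.Nonempty → Disjoint X Y → X ∪ Y = insert m (U \ M) →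
      (∀ x ∈ X, ∀ y ∈ Y, ¬G.Adj x y) → m ∈ X → G.IsSeparated U := by
    intro X Y hY hdis hXYU hXY hmX
    have hYU : ∀ y ∈ Y, y ∈ U ∧ y ∉ M := by
      intro y hy
      have : y ∈ insert m (U \ M) := hXYU ▸ Or.inr hy
      rcases this with rfl | hy'
      · exact absurd hy (Set.disjoint_left.1 hdis hmX)
      · exact hy'
    refine ⟨X ∪ M, Y, ⟨m, Or.inl hmX⟩, hY, ?_, ?_, ?_⟩
    · rw [Set.disjoint_union_left]
      exact ⟨hdis, Set.disjoint_right.2 fun y hy => (hYU y hy).2⟩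
    · ext x
      have h1 := Set.ext_iff.1 hXYU x
      simp only [Set.mem_union, Set.mem_insert_iff, Set.mem_sdiff] at h1 ⊢
      have h2 := @hMU x
      have h3 : x = m → x ∈ M := by rintro rfl; exact hm
      tauto
    · rintro x (hx | hx) y hy
      · exact hXY x hx y hy
      · rcases h y (hYU y hy).1 (hYU y hy).2 with h' | h'
        · exact fun hc => h' x hx hc.symm
        · exact absurd (h' m hm).symm (hXY m hmX y hy)
  have hmXY : m ∈ X ∪ Y := hXYU ▸ Or.inl rfl
  rcases hmXY with hmX | hmY
  · exact main X Y hY hdis hXYU hXY hmX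
  · exact main Y X hX hdis.symm (Set.union_comm X Y ▸ hXYU)
      (fun x hx y hy hc => hXY y hy x hx hc.symm) hmY

/-- The two patterns are those of a twin of the end `a` and of a twin of the midpoint `b`: in a
sparse graph vertices of a `P₄` have no twins. -/
lemma HasSparseP4.false_of_twin (hG : G.HasSparseP4) (hP : G.IsP4 a b c d) (hva : v ≠ a)
    (hvb : v ≠ b) (hvc : v ≠ c) (hvd : v ≠ d)
    (h : (G.Adj v b ∧ ¬G.Adj v c) ∨ (G.Adj v a ∧ ¬G.Adj v d)) : False := by
  have := hG hP hva hvb hvc hvd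
  tauto

/-- A spider of a quotient by a module lifts to the whole set. -/
lemma IsSpider.of_isModuleIn {S K : Set V} (hG : G.HasSparseP4) (h : G.IsModuleIn U M) (hMU : M ⊆ U)
    (hm : m ∈ M) (hv : v ∈ M) (hvm : v ≠ m) (hS : G.IsSpider (insert m (U \ M)) S K) :
    G.IsSpider U S K := by
  have hsub : insert m (U \ M) ⊆ U := by
    rintro x (rfl | hx)
    exacts [hMU hm, hx.1]
  have tw : ∀ x ∈ insert m (U \ M), x ≠ m → v ≠ x ∧ (G.Adj v x ↔ G.Adj m x) := by
    rintro x (rfl | ⟨hxU, hxM⟩) hne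
    · exact absurd rfl hne
    refine ⟨by rintro rfl; exact hxM hv, ?_⟩
    rcases h x hxU hxM with h | h
    · exact ⟨fun hc => absurd hc.symm (h v hv), fun hc => absurd hc.symm (h m hm)⟩
    · exact ⟨fun _ => (h m hm).symm, fun _ => (h v hv).symm⟩
  -- Legs and body vertices lie on a `P₄` of the quotient, where `v` would be a twin of `m`. So `m`
  -- lies in the head, and replacing it by `M` enlarges only the head.
  have hmS : m ∉ S := by
    intro hmS
    obtain ⟨b, hb, c, hc, d, hd, hP⟩ := hS.exists_isP4_leg m hmS
    obtain ⟨n1, n2, n3, -⟩ := hP.ne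
    have tb := tw b hb n1.symm
    have tc := tw c hc n2.symm
    exact hG.false_of_twin hP hvm tb.1 tc.1 (tw d hd n3.symm).1
      (Or.inl ⟨tb.2.2 hP.1, fun hh => hP.2.2.2.1 (tc.2.1 hh)⟩)
  have hmK : m ∉ K := by
    intro hmK
    obtain ⟨a, ha, c, hc, d, hd, hP⟩ := hS.exists_isP4_body m hmK
    obtain ⟨n1, n2, n3, n4, n5, n6⟩ := hP.ne
    have ta := tw a ha n1
    have td := tw d hd n5.symm
    exact hG.false_of_twin hP ta.1 hvm (tw c hc n4.symm).1 td.1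
      (Or.inr ⟨ta.2.2 hP.1.symm, fun hh => hP.2.2.2.2.1 (td.2.1 hh)⟩)
  have lift : ∀ x ∈ S ∪ K, ∀ r ∈ M, G.Adj x r ↔ G.Adj x m := by
    intro x hx r hr
    have hxm : x ≠ m := by
      rintro rfl
      exact hx.elim hmS hmK
    have hxU := (Set.union_subset hS.legs_subset hS.body_subset hx).resolve_left hxm
    rcases h x hxU.1 hxU.2 with h | h
    · simp [h r hr, h m hm]
    · simp [h r hr, h m hm]
  refine ⟨hS.disjoint, hS.legs_subset.trans hsub, hS.body_subset.trans hsub, hS.legs_nonempty,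
    hS.body_nontrivial, hS.isIndepSet, hS.isClique, ?_, ?_, ?_, ?_⟩
  · intro k hk r hr hrS hrK
    by_cases hrM : r ∈ M
    · exact (lift k (Or.inr hk) r hrM).2 (hS.adj_head k hk m (Or.inl rfl) hmS hmK)
    · exact hS.adj_head k hk r (Or.inr ⟨hr, hrM⟩) hrS hrK
  · intro s hs r hr hrS hrK
    by_cases hrM : r ∈ M
    · rw [lift s (Or.inl hs) r hrM]
      exact hS.not_adj_head s hs m (Or.inl rfl) hmS hmK
    · exact hS.not_adj_head s hs r (Or.inr ⟨hr, hrM⟩) hrS hrK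
  · intro s hs
    obtain ⟨b, hb, c, hc, d, hd, hP⟩ := hS.exists_isP4_leg s hs
    exact ⟨b, hsub hb, c, hsub hc, d, hsub hd, hP⟩
  · intro k hk
    obtain ⟨b, hb, c, hc, d, hd, hP⟩ := hS.exists_isP4_body k hk
    exact ⟨b, hsub hb, c, hsub hc, d, hsub hd, hP⟩

/-! ### Existence of spiders -/

lemma HasP4.exists_isIndexedSpider (h : G.HasP4 U) :
    ∃ s k : Fin 2 → V, G.IsIndexedSpider U True s k := by
  obtain ⟨a, ha, b, hb, c, hc, d, hd, h1, h2, h3, h4, h5, h6⟩ := h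
  refine ⟨![a, d], ![b, c], ?_, ?_, ?_, ?_, ?_⟩
  · simp [Fin.forall_fin_two, ha, hd]
  · simp [Fin.forall_fin_two, hb, hc]
  · simp [Fin.forall_fin_two, h2, h2.symm]
  · simp [Fin.forall_fin_two, h6, G.adj_comm d a]
  · simp [Fin.forall_fin_two, h1, h3.symm, h4, h5, G.adj_comm d b]

lemma HasP4.exists_maximal_isIndexedSpider [Finite V] (h : G.HasP4 U) :
    ∃ (n : ℕ) (thin : Prop) (s k : Fin n → V), 2 ≤ n ∧ G.IsIndexedSpider U thin s k ∧
      ∀ (thin' : Prop) (s' k' : Fin (n + 1) → V), ¬G.IsIndexedSpider U thin' s' k' := by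
  classical
  let P : ℕ → Prop := fun n => ∃ (thin : Prop) (s k : Fin n → V), G.IsIndexedSpider U thin s k
  obtain ⟨s₀, k₀, h₀⟩ := h.exists_isIndexedSpider
  have hP : P 2 := ⟨True, s₀, k₀, h₀⟩
  obtain ⟨thin, s, k, hsk⟩ := Nat.findGreatest_spec h₀.le_card hP
  refine ⟨Nat.findGreatest P (Nat.card V), thin, s, k, Nat.le_findGreatest h₀.le_card hP, hsk, ?_⟩
  intro thin' s' k' h'
  exact Nat.findGreatest_is_greatest (Nat.lt_succ_self _) h'.le_card ⟨thin', s', k', h'⟩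

/-- A connected and co-connected set of at least two vertices of a `P₄`-sparse graph induces a
spider. -/
theorem HasSparseP4.exists_isSpider [Finite V] (hG : G.HasSparseP4) (hU : U.Nontrivial)
    (h : ¬G.IsSeparated U) (h' : ¬Gᶜ.IsSeparated U) : ∃ S K, G.IsSpider U S K := by
  induction hN : U.ncard using Nat.strong_induction_on generalizing U with
  | _ N ih =>
  obtain ⟨n, thin, s, k, hn, hsk, hmax⟩ :=
    (hasP4_of_not_isSeparated hU h h').exists_maximal_isIndexedSpider
  have hmax' : ∀ (thin' : Prop) (s' k' : Fin (n + 1) → V), ¬Gᶜ.IsIndexedSpider U thin' s' k' :=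
    fun thin' s' k' hc => hmax _ _ _ (by simpa using hc.compl (by omega))
  have hne := hsk.leg_ne_body hn
  -- The maximal spider together with its would-be head. Maximality makes this a module.
  let M : Set V := {v | v ∈ U ∧ ((∃ i, v = s i) ∨ (∃ i, v = k i) ∨
    ((∀ i, v ≠ s i) ∧ (∀ i, v ≠ k i) ∧ ∀ i, ¬G.Adj v (s i) ∧ G.Adj v (k i)))}
  have hMU : M ⊆ U := fun v hv => hv.1
  have hsM : ∀ i, s i ∈ M := fun i => ⟨hsk.mem_leg i, Or.inl ⟨i, rfl⟩⟩
  have hkM : ∀ i, k i ∈ M := fun i => ⟨hsk.mem_body i, Or.inr (Or.inl ⟨i, rfl⟩)⟩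
  have hmod : G.IsModuleIn U M := by
    intro v hv hvM
    have hvs : ∀ i, v ≠ s i := fun i hi => hvM (hi ▸ hsM i)
    have hvk : ∀ i, v ≠ k i := fun i hi => hvM (hi ▸ hkM i)
    rcases hsk.adj_cases hG hn hvs hvk with hc | hc | hc
    · left
      rintro x ⟨hx, ⟨i, rfl⟩ | ⟨i, rfl⟩ | ⟨-, -, hxa⟩⟩
      · exact (hc i).1
      · exact (hc i).2
      · exact fun hh => hsk.not_adj_of_maximal hG hn hmax hx hv hxa hc hh.symm
    · exact absurd ⟨hv, Or.inr (Or.inr ⟨hvs, hvk, hc⟩)⟩ hvM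
    · right
      rintro x ⟨hx, ⟨i, rfl⟩ | ⟨i, rfl⟩ | ⟨hxs, hxk, hxa⟩⟩
      · exact (hc i).1
      · exact (hc i).2
      · by_contra hh
        -- In the complement `x` still sees exactly the body, which is now formed by the legs, while
        -- `v` sees nothing of the spider.
        refine (hsk.compl hn).not_adj_of_maximal hG.compl hn hmax' hx hv
          (fun i => ⟨fun h1 => h1.2 (hxa i).2, hxs i, (hxa i).1⟩)
          (fun i => ⟨fun h1 => h1.2 (hc i).2, fun h1 => h1.2 (hc i).1⟩)
          ⟨?_, fun h1 => hh h1.symm⟩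
        rintro rfl
        exact (hxa ⟨0, by omega⟩).1 (hc _).1
  let o : Fin n := ⟨0, by omega⟩
  by_cases hUM : U ⊆ M
  · have head : ∀ r ∈ U, r ∉ Set.range s → r ∉ Set.range k →
        ∀ i, ¬G.Adj r (s i) ∧ G.Adj r (k i) := by
      intro r hr hrs hrk
      rcases (hUM hr).2 with ⟨i, rfl⟩ | ⟨i, rfl⟩ | ⟨-, -, hr⟩
      · exact absurd ⟨i, rfl⟩ hrs
      · exact absurd ⟨i, rfl⟩ hrk
      · exact hr
    refine ⟨Set.range s, Set.range k, ?_, ?_, ?_, ⟨s o, o, rfl⟩, ?_, ?_, ?_, ?_, ?_, ?_, ?_⟩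
    · rw [Set.disjoint_left]
      rintro _ ⟨i, rfl⟩ ⟨j, hj⟩
      exact hne i j hj.symm
    · rintro _ ⟨i, rfl⟩
      exact hsk.mem_leg i
    · rintro _ ⟨i, rfl⟩
      exact hsk.mem_body i
    · obtain ⟨l, hl⟩ := IsIndexedSpider.exists_ne_of_two_le hn o
      exact ⟨k l, ⟨l, rfl⟩, k o, ⟨o, rfl⟩, hsk.body_ne hl⟩
    · rintro _ ⟨i, rfl⟩ _ ⟨j, rfl⟩ -
      exact hsk.not_adj_leg i j
    · rintro _ ⟨i, rfl⟩ _ ⟨j, rfl⟩ hij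
      exact hsk.adj_body i j (by rintro rfl; exact hij rfl)
    · rintro _ ⟨i, rfl⟩ r hr hrs hrk
      exact (head r hr hrs hrk i).2.symm
    · rintro _ ⟨i, rfl⟩ r hr hrs hrk hc
      exact (head r hr hrs hrk i).1 hc.symm
    · rintro _ ⟨i, rfl⟩
      obtain ⟨j, hj⟩ := IsIndexedSpider.exists_ne_of_two_le hn i
      by_cases ht : thin
      · exact ⟨_, hsk.mem_body i, _, hsk.mem_body j, _, hsk.mem_leg j, hsk.isP4_thin ht hj.symm⟩
      · exact ⟨_, hsk.mem_body j, _, hsk.mem_body i, _, hsk.mem_leg j, hsk.isP4_thick ht hj.symm⟩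
    · rintro _ ⟨i, rfl⟩
      obtain ⟨j, hj⟩ := IsIndexedSpider.exists_ne_of_two_le hn i
      by_cases ht : thin
      · exact ⟨_, hsk.mem_leg i, _, hsk.mem_body j, _, hsk.mem_leg j, hsk.isP4_thin ht hj.symm⟩
      · exact ⟨_, hsk.mem_leg j, _, hsk.mem_body j, _, hsk.mem_leg i, hsk.isP4_thick ht hj⟩
  · obtain ⟨v, hvU, hvM⟩ := Set.not_subset.1 hUM
    -- Contract `M` to `s o`. The quotient is smaller because it loses `k o`, which then serves as
    -- the twin of `s o`.
    have hlt : (insert (s o) (U \ M)).ncard < N := by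
      rw [← hN]
      refine Set.ncard_lt_ncard ⟨?_, fun hc => ?_⟩
      · rintro x (rfl | hx)
        exacts [hsk.mem_leg o, hx.1]
      · rcases hc (hsk.mem_body o) with he | he
        · exact hne _ _ he.symm
        · exact he.2 (hkM o)
    obtain ⟨S, K, hSK⟩ := ih _ hlt
      ⟨s o, Or.inl rfl, v, Or.inr ⟨hvU, hvM⟩, by rintro rfl; exact hvM (hsM o)⟩
      (fun hc => h (hmod.isSeparated hMU (hsM o) hc))
      (fun hc => h' (hmod.compl.isSeparated hMU (hsM o) hc)) rfl
    exact ⟨S, K, IsSpider.of_isModuleIn hG hmod hMU (hsM o) (hkM o) (hne o o).symm hSK⟩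

/-! ### Polar, monopolar and split sets -/

/-- The set `A` induces a complete multipartite graph. -/
def IsMultipartiteOn (G : SimpleGraph V) (A : Set V) : Prop :=
  ∀ x ∈ A, ∀ y ∈ A, ∀ z ∈ A, ¬G.Adj x y → ¬G.Adj y z → ¬G.Adj x z

/-- The set `B` induces a cluster. -/
def IsClusterOn (G : SimpleGraph V) (B : Set V) : Prop :=
  ∀ x ∈ B, ∀ y ∈ B, ∀ z ∈ B, G.Adj x y → G.Adj y z → x ≠ z → G.Adj x z

/-- The set `U` induces a polar graph. -/
def IsPolarOn (G : SimpleGraph V) (U : Set V) : Prop :=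
  ∃ A, G.IsMultipartiteOn (U ∩ A) ∧ G.IsClusterOn (U \ A)

/-- The set `U` induces a monopolar graph: a stable set and a cluster. -/
def IsMonopolarOn (G : SimpleGraph V) (U : Set V) : Prop :=
  ∃ A, G.IsIndepSet (U ∩ A) ∧ G.IsClusterOn (U \ A)

/-- The set `U` induces a split graph: a stable set and a clique. -/
def IsSplitOn (G : SimpleGraph V) (U : Set V) : Prop :=
  ∃ A, G.IsIndepSet (U ∩ A) ∧ G.IsClique (U \ A)

lemma IsClusterOn.mono (h : G.IsClusterOn B) (hAB : A ⊆ B) : G.IsClusterOn A :=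
  fun x hx y hy z hz => h x (hAB hx) y (hAB hy) z (hAB hz)

lemma IsMultipartiteOn.mono (h : G.IsMultipartiteOn B) (hAB : A ⊆ B) : G.IsMultipartiteOn A :=
  fun x hx y hy z hz => h x (hAB hx) y (hAB hy) z (hAB hz)

lemma isMultipartiteOn_compl : Gᶜ.IsMultipartiteOn A ↔ G.IsClusterOn A := by
  have key : ∀ x y, ¬Gᶜ.Adj x y ↔ (x = y ∨ G.Adj x y) := by
    intro x y
    rw [compl_adj]
    tauto
  simp only [IsMultipartiteOn, IsClusterOn, key]
  refine ⟨fun h x hx y hy z hz hxy hyz hne =>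
    (h x hx y hy z hz (Or.inr hxy) (Or.inr hyz)).resolve_left hne, ?_⟩
  rintro h x hx y hy z hz (rfl | hxy) (rfl | hyz)
  · exact Or.inl rfl
  · exact Or.inr hyz
  · exact Or.inr hxy
  · by_cases hne : x = z
    · exact Or.inl hne
    · exact Or.inr (h x hx y hy z hz hxy hyz hne)

lemma isClusterOn_compl : Gᶜ.IsClusterOn A ↔ G.IsMultipartiteOn A := by
  rw [← isMultipartiteOn_compl, compl_compl]

lemma isCompleteMultipartite_induce : (G.induce A).IsCompleteMultipartite ↔
    G.IsMultipartiteOn A :=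
  ⟨fun h x hx y hy z hz => h.trans ⟨x, hx⟩ ⟨y, hy⟩ ⟨z, hz⟩,
    fun h => ⟨fun x y z => h x x.2 y y.2 z z.2⟩⟩

lemma isCluster_induce : (G.induce B).IsCluster ↔ G.IsClusterOn B := by
  rw [IsCluster, ← induce_compl, isCompleteMultipartite_induce, isMultipartiteOn_compl]

lemma isPolar_iff : G.IsPolar ↔ G.IsPolarOn Set.univ := by
  constructor
  · rintro ⟨A, B, hAB, hA, hB⟩
    refine ⟨A, ?_, ?_⟩
    · rw [Set.univ_inter]
      exact isCompleteMultipartite_induce.1 hA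
    · rw [← Set.compl_eq_univ_sdiff, hAB.compl_eq]
      exact isCluster_induce.1 hB
  · rintro ⟨A, hA, hB⟩
    rw [Set.univ_inter] at hA
    rw [← Set.compl_eq_univ_sdiff] at hB
    exact ⟨A, Aᶜ, isCompl_compl, isCompleteMultipartite_induce.2 hA, isCluster_induce.2 hB⟩

lemma IsPolar.isPolarOn (h : (G.induce U).IsPolar) : G.IsPolarOn U := by
  obtain ⟨A, hA, hB⟩ := isPolar_iff.1 h
  refine ⟨Subtype.val '' A, ?_, ?_⟩
  · rintro _ ⟨-, x, hx, rfl⟩ _ ⟨-, y, hy, rfl⟩ _ ⟨-, z, hz, rfl⟩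
    exact hA x ⟨trivial, hx⟩ y ⟨trivial, hy⟩ z ⟨trivial, hz⟩
  · rintro x ⟨hxU, hx⟩ y ⟨hyU, hy⟩ z ⟨hzU, hz⟩ hxy hyz hxz
    exact hB ⟨x, hxU⟩ ⟨trivial, fun h => hx ⟨_, h, rfl⟩⟩ ⟨y, hyU⟩ ⟨trivial, fun h => hy ⟨_, h, rfl⟩⟩
      ⟨z, hzU⟩ ⟨trivial, fun h => hz ⟨_, h, rfl⟩⟩ hxy hyz (by simpa using hxz)

lemma IsPolarOn.compl (h : G.IsPolarOn U) : Gᶜ.IsPolarOn U := by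
  obtain ⟨A, hA, hB⟩ := h
  refine ⟨Aᶜ, ?_, ?_⟩
  · rw [isMultipartiteOn_compl]
    exact hB
  · rw [isClusterOn_compl]
    exact hA.mono fun x hx => ⟨hx.1, not_not.1 hx.2⟩

lemma isPolarOn_compl : Gᶜ.IsPolarOn U ↔ G.IsPolarOn U :=
  ⟨fun h => by simpa using h.compl, IsPolarOn.compl⟩

lemma IsClusterOn.union (hX : G.IsClusterOn X) (hY : G.IsClusterOn Y)
    (hXY : ∀ x ∈ X, ∀ y ∈ Y, ¬G.Adj x y) : G.IsClusterOn (X ∪ Y) := by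
  have key : ∀ {x y}, G.Adj x y → x ∈ X ∪ Y → y ∈ X ∪ Y → (x ∈ X ∧ y ∈ X) ∨ (x ∈ Y ∧ y ∈ Y) := by
    rintro x y hxy (hx | hx) (hy | hy)
    · exact Or.inl ⟨hx, hy⟩
    · exact absurd hxy (hXY x hx y hy)
    · exact absurd hxy.symm (hXY y hy x hx)
    · exact Or.inr ⟨hx, hy⟩
  intro x hx y hy z hz hxy hyz
  rcases key hxy hx hy with ⟨hx', hy'⟩ | ⟨hx', hy'⟩
  · rcases key hyz hy hz with ⟨-, hz'⟩ | ⟨h1, hz'⟩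
    · exact hX x hx' y hy' z hz' hxy hyz
    · exact absurd hyz.symm (fun h => hXY x hx' y h1 hxy)
  · rcases key hyz hy hz with ⟨h1, hz'⟩ | ⟨-, hz'⟩
    · exact absurd hxy.symm (hXY y h1 x hx')
    · exact hY x hx' y hy' z hz' hxy hyz

lemma IsMonopolarOn.union (hX : G.IsMonopolarOn X) (hY : G.IsMonopolarOn Y)
    (hdis : Disjoint X Y) (hXY : ∀ x ∈ X, ∀ y ∈ Y, ¬G.Adj x y) : G.IsMonopolarOn (X ∪ Y) := by
  obtain ⟨A, hA, hA'⟩ := hX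
  obtain ⟨B, hB, hB'⟩ := hY
  have d1 : ∀ x ∈ X, x ∉ Y := fun x hx => Set.disjoint_left.1 hdis hx
  refine ⟨(X ∩ A) ∪ (Y ∩ B), ?_, (hA'.union hB' fun x hx y hy => hXY x hx.1 y hy.1).mono ?_⟩
  · rintro x ⟨-, hx | hx⟩ y ⟨-, hy | hy⟩ hxy
    · exact hA hx hy hxy
    · exact hXY x hx.1 y hy.1
    · exact fun hc => hXY y hy.1 x hx.1 hc.symm
    · exact hB hx hy hxy
  · rintro x ⟨hx | hx, hn⟩
    · exact Or.inl ⟨hx, fun h => hn (Or.inl ⟨hx, h⟩)⟩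
    · exact Or.inr ⟨hx, fun h => hn (Or.inr ⟨hx, h⟩)⟩

lemma IsMonopolarOn.isPolarOn (h : G.IsMonopolarOn U) : G.IsPolarOn U := by
  obtain ⟨A, hA, hB⟩ := h
  refine ⟨A, fun x hx y hy z hz _ _ hc => hA hx hz hc.ne hc, hB⟩

lemma IsSplitOn.isMonopolarOn (h : G.IsSplitOn U) : G.IsMonopolarOn U := by
  obtain ⟨A, hA, hB⟩ := h
  exact ⟨A, hA, fun x hx y hy z hz _ _ hne => hB hx hz hne⟩

lemma IsPolarOn.union_isClusterOn (hX : G.IsPolarOn X) (hY : G.IsClusterOn Y)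
    (hXY : ∀ x ∈ X, ∀ y ∈ Y, ¬G.Adj x y) : G.IsPolarOn (X ∪ Y) := by
  obtain ⟨A, hA, hB⟩ := hX
  refine ⟨X ∩ A, hA.mono fun x hx => hx.2,
    (hB.union hY fun x hx y hy => hXY x hx.1 y hy).mono ?_⟩
  rintro x ⟨hx | hx, hn⟩
  · exact Or.inl ⟨hx, fun h => hn ⟨hx, h⟩⟩
  · exact Or.inr hx

/-- A set that is not monopolar together with an induced `P₃` far from it is not polar. -/
lemma not_isPolarOn_of_isClusterOn (hX : ¬G.IsMonopolarOn X) (hY : ¬G.IsClusterOn Y)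
    (hXU : X ⊆ U) (hYU : Y ⊆ U) (hXY : ∀ x ∈ X, ∀ y ∈ Y, ¬G.Adj x y) : ¬G.IsPolarOn U := by
  rintro ⟨A, hA, hB⟩
  have hind : ¬G.IsIndepSet (X ∩ A) := fun h =>
    hX ⟨A, h, hB.mono (Set.sdiff_subset_sdiff_left hXU)⟩
  simp only [IsIndepSet, Set.Pairwise, not_forall, not_not] at hind
  obtain ⟨x, hx, y, hy, -, hxy⟩ := hind
  -- An edge of `X` inside `A` together with any vertex of `Y` in `A` would not be complete
  -- multipartite, so all of `Y` falls into the cluster.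
  refine hY (hB.mono fun w hw => ⟨hYU hw, fun hwA => ?_⟩)
  exact hA x ⟨hXU hx.1, hx.2⟩ w ⟨hYU hw, hwA⟩ y ⟨hXU hy.1, hy.2⟩ (hXY x hx.1 w hw)
    (fun hc => hXY y hy.1 w hw hc.symm) hxy

/-- The body vertices are singleton parts joined to the whole head, the legs are isolated from it;
each side of the partition keeps its type. -/
lemma IsSpider.isPolarOn {S K : Set V} (h : G.IsSpider U S K)
    (hR : G.IsPolarOn (U \ (S ∪ K))) : G.IsPolarOn U := by
  obtain ⟨A, hA, hB⟩ := hR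
  have hR : ∀ r ∈ U \ (S ∪ K), ∀ k ∈ K, G.Adj k r := fun r hr k hk =>
    h.adj_head k hk r hr.1 (fun hc => hr.2 (Or.inl hc)) (fun hc => hr.2 (Or.inr hc))
  have hclique : ∀ x ∈ K, ∀ y ∈ K, ¬G.Adj x y → x = y := fun x hx y hy hc =>
    not_not.1 fun hne => hc (h.isClique hx hy hne)
  refine ⟨((U \ (S ∪ K)) ∩ A) ∪ K, IsMultipartiteOn.mono (B := ((U \ (S ∪ K)) ∩ A) ∪ K) ?_
    Set.inter_subset_right, IsClusterOn.mono (B := ((U \ (S ∪ K)) \ A) ∪ S) ?_ ?_⟩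
  · rintro x (hx | hx) y (hy | hy) z (hz | hz) hxy hyz
    · exact hA x hx y hy z hz hxy hyz
    · exact absurd (hR y hy.1 z hz).symm hyz
    · exact absurd (hR x hx.1 y hy).symm hxy
    · exact absurd (hR x hx.1 y hy).symm hxy
    · exact absurd (hR y hy.1 x hx) hxy
    · exact absurd (hR y hy.1 x hx) hxy
    · exact absurd (hR z hz.1 y hy) hyz
    · obtain rfl := hclique x hx y hy hxy
      exact hyz
  · refine hB.union (fun x hx y hy z hz hxy _ _ => absurd hxy (h.isIndepSet hx hy hxy.ne)) ?_
    rintro r ⟨hr, -⟩ s hs hc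
    exact h.not_adj_head s hs r hr.1 (fun hc => hr.2 (Or.inl hc)) (fun hc => hr.2 (Or.inr hc))
      hc.symm
  · rintro x ⟨hxU, hx⟩
    by_cases hxS : x ∈ S
    · exact Or.inr hxS
    · have hxR : x ∈ U \ (S ∪ K) := ⟨hxU, fun hc => hc.elim hxS fun hK => hx (Or.inr hK)⟩
      exact Or.inl ⟨hxR, fun hc => hx (Or.inl ⟨hxR, hc⟩)⟩

lemma IsSpider.isSplitOn {S K : Set V} (h : G.IsSpider U S K)
    (hR : G.IsSplitOn (U \ (S ∪ K))) : G.IsSplitOn U := by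
  obtain ⟨A, hA, hB⟩ := hR
  have hR : ∀ r ∈ U \ (S ∪ K), r ∉ S ∧ r ∉ K := fun r hr => not_or.1 hr.2
  refine ⟨((U \ (S ∪ K)) ∩ A) ∪ S, ?_, ?_⟩
  · rintro x ⟨-, hx | hx⟩ y ⟨-, hy | hy⟩ hxy
    · exact hA hx hy hxy
    · exact fun hc => h.not_adj_head y hy x hx.1.1 (hR x hx.1).1 (hR x hx.1).2 hc.symm
    · exact h.not_adj_head x hx y hy.1.1 (hR y hy.1).1 (hR y hy.1).2
    · exact h.isIndepSet hx hy hxy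
  · have hmem : ∀ x ∈ U \ (((U \ (S ∪ K)) ∩ A) ∪ S), x ∈ (U \ (S ∪ K)) \ A ∨ x ∈ K := by
      rintro x ⟨hxU, hx⟩
      by_cases hxK : x ∈ K
      · exact Or.inr hxK
      · have hxR : x ∈ U \ (S ∪ K) := ⟨hxU, fun hc => hc.elim (fun hS => hx (Or.inr hS)) hxK⟩
        exact Or.inl ⟨hxR, fun hc => hx (Or.inl ⟨hxR, hc⟩)⟩
    intro x hx y hy hxy
    rcases hmem x hx with hx | hx <;> rcases hmem y hy with hy | hy
    · exact hB hx hy hxy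
    · exact (h.adj_head y hy x hx.1.1 (hR x hx.1).1 (hR x hx.1).2).symm
    · exact h.adj_head x hx y hy.1.1 (hR y hy.1).1 (hR y hy.1).2
    · exact h.isClique hx hy hxy

/-- The body and a head that is not split already fail to be monopolar. -/
lemma IsSpider.not_isMonopolarOn {S K : Set V} (h : G.IsSpider U S K)
    (hR : ¬G.IsSplitOn (U \ (S ∪ K))) : ¬G.IsMonopolarOn (U \ S) := by
  rintro ⟨A, hA, hB⟩
  have hKU : ∀ k ∈ K, k ∈ U \ S :=
    fun k hk => ⟨h.body_subset hk, fun hs => Set.disjoint_left.1 h.disjoint hs hk⟩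
  have hRU : ∀ r ∈ U \ (S ∪ K), r ∈ U \ S := fun r hr => ⟨hr.1, fun hs => hr.2 (Or.inl hs)⟩
  -- A stable set cannot contain two body vertices. Since `k` sees the whole head, the head's share
  -- of the cluster is a clique.
  obtain ⟨k, hk, hkA⟩ : ∃ k ∈ K, k ∉ A := by
    by_contra! hc
    obtain ⟨k, hk, l, hl, hkl⟩ := h.body_nontrivial
    exact hA ⟨hKU k hk, hc k hk⟩ ⟨hKU l hl, hc l hl⟩ hkl (h.isClique hk hl hkl)
  have hkR : ∀ r ∈ U \ (S ∪ K), G.Adj k r := fun r hr =>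
    h.adj_head k hk r hr.1 (fun hc => hr.2 (Or.inl hc)) (fun hc => hr.2 (Or.inr hc))
  refine hR ⟨A, fun x hx y hy => hA ⟨hRU x hx.1, hx.2⟩ ⟨hRU y hy.1, hy.2⟩, ?_⟩
  rintro x ⟨hx, hxA⟩ y ⟨hy, hyA⟩ hxy
  exact hB x ⟨hRU x hx, hxA⟩ k ⟨hKU k hk, hkA⟩ y ⟨hRU y hy, hyA⟩ (hkR x hx).symm (hkR y hy) hxy

lemma IsSplitOn.union_isIndepSet (hX : G.IsSplitOn X) (hY : G.IsIndepSet Y)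
    (hXY : ∀ x ∈ X, ∀ y ∈ Y, ¬G.Adj x y) : G.IsSplitOn (X ∪ Y) := by
  obtain ⟨A, hA, hB⟩ := hX
  refine ⟨(X ∩ A) ∪ Y, ?_, hB.subset ?_⟩
  · rintro x ⟨-, hx | hx⟩ y ⟨-, hy | hy⟩ hxy
    · exact hA hx hy hxy
    · exact hXY x hx.1 y hy
    · exact fun hc => hXY y hy.1 x hx hc.symm
    · exact hY hx hy hxy
  · rintro x ⟨hx | hx, hn⟩
    · exact ⟨hx, fun hc => hn (Or.inl ⟨hx, hc⟩)⟩
    · exact absurd (Or.inr hx) hn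

lemma IsSplitOn.compl (h : G.IsSplitOn U) : Gᶜ.IsSplitOn U := by
  obtain ⟨A, hA, hB⟩ := h
  refine ⟨Aᶜ, ?_, ?_⟩
  · rw [isIndepSet_compl]
    exact hB
  · rw [isClique_compl]
    have hsub : U \ Aᶜ ⊆ U ∩ A := fun x hx => ⟨hx.1, not_not.1 hx.2⟩
    exact hA.mono hsub

lemma isSplitOn_compl : Gᶜ.IsSplitOn U ↔ G.IsSplitOn U :=
  ⟨fun h => by simpa using h.compl, IsSplitOn.compl⟩

/-- Two edges without edges between them are not contained in a split set. -/
lemma not_isSplitOn_of_two_edges (ha : a ∈ U) (hb : b ∈ U) (hc : c ∈ U) (hd : d ∈ U)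
    (hab : G.Adj a b) (hcd : G.Adj c d) (hac : Gᶜ.Adj a c) (had : Gᶜ.Adj a d) (hbc : Gᶜ.Adj b c)
    (hbd : Gᶜ.Adj b d) : ¬G.IsSplitOn U := by
  rintro ⟨A, hA, hB⟩
  have key : ∀ {x y}, x ∈ U → y ∈ U → G.Adj x y → x ∉ A ∨ y ∉ A := by
    intro x y hx hy hxy
    by_contra! hc
    exact hA ⟨hx, hc.1⟩ ⟨hy, hc.2⟩ hxy.ne hxy
  have key' : ∀ {x y}, x ∈ U → y ∈ U → Gᶜ.Adj x y → x ∈ A ∨ y ∈ A := by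
    intro x y hx hy hxy
    by_contra! hc
    exact hxy.2 (hB ⟨hx, hc.1⟩ ⟨hy, hc.2⟩ hxy.ne)
  have := key ha hb hab
  have := key hc hd hcd
  have := key' ha hc hac
  have := key' ha hd had
  have := key' hb hc hbc
  have := key' hb hd hbd
  -- Each edge has an end outside `A`, and these two ends are not adjacent.
  tauto

lemma HasP4.nontrivial (h : G.HasP4 U) : U.Nontrivial := by
  obtain ⟨a, ha, b, hb, c, hc, d, hd, h⟩ := h
  exact ⟨a, ha, b, hb, h.ne.1⟩

lemma IsP4.not_isClusterOn (h : G.IsP4 a b c d) (ha : a ∈ U) (hb : b ∈ U) (hc : c ∈ U) :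
    ¬G.IsClusterOn U := fun hU => h.2.2.2.1 (hU a ha b hb c hc h.1 h.2.1 h.ne.2.1)

lemma not_hasP4_triple (p q r : V) : ¬G.HasP4 {p, q, r} := by
  classical
  rintro ⟨a, ha, b, hb, c, hc, d, hd, h⟩
  obtain ⟨n1, n2, n3, n4, n5, n6⟩ := h.ne
  have hsub : ({a, b, c, d} : Finset V) ⊆ {p, q, r} := by
    intro x hx
    simp only [Finset.mem_insert, Finset.mem_singleton] at hx ⊢
    rcases hx with rfl | rfl | rfl | rfl <;> assumption
  have h4 : ({a, b, c, d} : Finset V).card = 4 := by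
    simp [n1, n2, n3, n4, n5, n6]
  have := (Finset.card_le_card hsub).trans Finset.card_le_three
  omega

/-- Five vertices, four of them on a path, which miss the remaining vertex of the path. -/
lemma IsP4.insert_ne {P Q : Set V} (h : G.IsP4 a b c d) (hd : d ∈ P) (hy : y ∈ Q) (hz : z ∈ Q)
    (hdis : Disjoint P Q) : ({a, b, c, y, z} : Set V) ≠ P ∪ Q := by
  intro he
  obtain ⟨-, -, n3, -, n5, n6⟩ := h.ne
  have hdm : d ∈ ({a, b, c, y, z} : Set V) := he ▸ Or.inl hd
  have hdQ : d ∉ Q := Set.disjoint_left.1 hdis hd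
  rcases hdm with rfl | rfl | rfl | rfl | rfl
  · exact n3 rfl
  · exact n5 rfl
  · exact n6 rfl
  · exact hdQ hy
  · exact hdQ hz

lemma adj_of_not_compl_adj {P Q : Set V} (hdis : Disjoint P Q)
    (hPQ : ∀ x ∈ P, ∀ y ∈ Q, ¬Gᶜ.Adj x y) : ∀ x ∈ P, ∀ y ∈ Q, G.Adj x y := fun x hx y hy => by
  by_contra hc
  exact hPQ x hx y hy ⟨fun he => Set.disjoint_left.1 hdis hx (he ▸ hy), hc⟩

lemma compl_adj_of_not_adj {P Q : Set V} (hdis : Disjoint P Q)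
    (hPQ : ∀ x ∈ P, ∀ y ∈ Q, ¬G.Adj x y) : ∀ x ∈ P, ∀ y ∈ Q, Gᶜ.Adj x y :=
  fun x hx y hy => ⟨fun he => Set.disjoint_left.1 hdis hx (he ▸ hy), hPQ x hx y hy⟩

lemma IsClusterOn.isMonopolarOn (h : G.IsClusterOn U) : G.IsMonopolarOn U :=
  ⟨∅, by simp, by simpa using h⟩

lemma IsSpider.sdiff_ne {S K : Set V} (h : G.IsSpider U S K) : U \ S ≠ U := by
  obtain ⟨s, hs⟩ := h.legs_nonempty
  intro he
  exact (he.ge (h.legs_subset hs)).2 hs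

/-- A head that is not split would make the spider without its legs non-monopolar already, against
minimality; a split head makes the spider split. -/
lemma IsSpider.isSplitOn_of_minimal {S K : Set V} (h : G.IsSpider U S K)
    (hmin : ∀ W ⊆ U, W ≠ U → G.IsMonopolarOn W) : G.IsSplitOn U := by
  by_contra hU
  exact h.not_isMonopolarOn (fun hR => hU (h.isSplitOn hR))
    (hmin _ Set.sdiff_subset h.sdiff_ne)

lemma insert_five_subset {P Q : Set V} (ha : a ∈ P) (hb : b ∈ P) (hc : c ∈ P) (hy : y ∈ Q)
    (hz : z ∈ Q) : ({a, b, c, y, z} : Set V) ⊆ P ∪ Q := by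
  rintro x (rfl | rfl | rfl | rfl | rfl)
  exacts [Or.inl ha, Or.inl hb, Or.inl hc, Or.inr hy, Or.inr hz]

lemma not_isIndepSet_iff : ¬G.IsIndepSet U ↔ ∃ y ∈ U, ∃ z ∈ U, G.Adj y z := by
  simp only [IsIndepSet, Set.Pairwise, not_forall, not_not]
  exact ⟨fun ⟨y, hy, z, hz, _, h⟩ => ⟨y, hy, z, hz, h⟩, fun ⟨y, hy, z, hz, h⟩ =>
    ⟨y, hy, z, hz, h.ne, h⟩⟩

/-! ### Minimal non-split and non-monopolar sets -/

/-- In a `P₄`-sparse graph, no minimal set that is neither split nor a cluster contains a `P₄`. -/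
lemma HasSparseP4.isSplitOn_of_minimal [Finite V] (hG : G.HasSparseP4) (hP : G.HasP4 U)
    (hmin : ∀ W ⊆ U, W ≠ U → G.IsSplitOn W ∨ G.IsClusterOn W) : G.IsSplitOn U := by
  by_cases hs : G.IsSeparated U
  · obtain ⟨P, Q, hPne, hQne, hdis, rfl, hPQ⟩ := hs
    have main : ∀ P Q : Set V, Q.Nonempty → Disjoint P Q → (∀ x ∈ P, ∀ y ∈ Q, ¬G.Adj x y) →
        (∀ W ⊆ P ∪ Q, W ≠ P ∪ Q → G.IsSplitOn W ∨ G.IsClusterOn W) → G.HasP4 P →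
        G.IsSplitOn (P ∪ Q) := by
      rintro P Q ⟨q, hq⟩ hdis hPQ hmin ⟨a, ha, b, hb, c, hc, d, hd, h⟩
      have hPs := (hmin P Set.subset_union_left (fun he =>
        Set.disjoint_right.1 hdis hq (he ▸ Or.inr hq))).resolve_right (h.not_isClusterOn ha hb hc)
      refine hPs.union_isIndepSet ?_ hPQ
      by_contra hQ
      obtain ⟨y, hy, z, hz, hyz⟩ := not_isIndepSet_iff.1 hQ
      have hPQ' := compl_adj_of_not_adj hdis hPQ
      -- This set is proper, as it misses `d`; it contains two independent edges and the `P₃` on `a,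
      -- b, c`, so it is neither split nor a cluster.
      rcases hmin {a, b, c, y, z} (insert_five_subset ha hb hc hy hz)
        (h.insert_ne hd hy hz hdis) with h' | h'
      · exact not_isSplitOn_of_two_edges (by simp) (by simp) (by simp) (by simp) h.1 hyz
          (hPQ' a ha y hy) (hPQ' a ha z hz) (hPQ' b hb y hy) (hPQ' b hb z hz) h'
      · exact h.not_isClusterOn (by simp) (by simp) (by simp) h'
    rcases hP.of_union hPQ with hP | hP
    · exact main P Q hQne hdis hPQ hmin hP
    · rw [Set.union_comm] at hmin ⊢
      exact main Q P hPne hdis.symm (fun x hx y hy hc => hPQ y hy x hx hc.symm) hmin hP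
  by_cases hs' : Gᶜ.IsSeparated U
  · obtain ⟨P, Q, hPne, hQne, hdis, rfl, hPQ⟩ := hs'
    have main : ∀ P Q : Set V, Q.Nonempty → Disjoint P Q → (∀ x ∈ P, ∀ y ∈ Q, ¬Gᶜ.Adj x y) →
        (∀ W ⊆ P ∪ Q, W ≠ P ∪ Q → G.IsSplitOn W ∨ G.IsClusterOn W) → G.HasP4 P →
        G.IsSplitOn (P ∪ Q) := by
      rintro P Q ⟨q, hq⟩ hdis hPQ hmin ⟨a, ha, b, hb, c, hc, d, hd, h⟩
      have hPs := (hmin P Set.subset_union_left (fun he =>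
        Set.disjoint_right.1 hdis hq (he ▸ Or.inr hq))).resolve_right (h.not_isClusterOn ha hb hc)
      refine isSplitOn_compl.1 (hPs.compl.union_isIndepSet ?_ hPQ)
      by_contra hQ
      obtain ⟨y, hy, z, hz, hyz⟩ := not_isIndepSet_iff.1 hQ
      have hPQ' := compl_adj_of_not_adj hdis hPQ
      rcases hmin {a, b, c, y, z} (insert_five_subset ha hb hc hy hz)
        (h.insert_ne hd hy hz hdis) with h' | h'
      · exact not_isSplitOn_of_two_edges (by simp) (by simp) (by simp) (by simp)
          (⟨h.ne.2.1, h.2.2.2.1⟩ : Gᶜ.Adj a c) hyz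
          (hPQ' a ha y hy) (hPQ' a ha z hz) (hPQ' c hc y hy) (hPQ' c hc z hz) h'.compl
      · exact h.not_isClusterOn (by simp) (by simp) (by simp) h'
    rcases hP.compl.of_union hPQ with hP | hP
    · exact main P Q hQne hdis hPQ hmin (hasP4_compl.1 hP)
    · rw [Set.union_comm] at hmin ⊢
      exact main Q P hPne hdis.symm (fun x hx y hy hc => hPQ y hy x hx hc.symm) hmin
        (hasP4_compl.1 hP)
  obtain ⟨S, K, h⟩ := hG.exists_isSpider hP.nontrivial hs hs'
  exact h.isSplitOn_of_minimal fun W hW hne =>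
    (hmin W hW hne).elim IsSplitOn.isMonopolarOn IsClusterOn.isMonopolarOn

/-- If the dominating vertex `z` is in the stable part, nothing else is, and `W` is a cluster; if it
is in the cluster, it forces that part to be a clique. -/
lemma IsMonopolarOn.isSplitOn_or_isClusterOn {W : Set V} (h : G.IsMonopolarOn (insert z W))
    (hz : ∀ x ∈ W, G.Adj x z) : G.IsSplitOn W ∨ G.IsClusterOn W := by
  obtain ⟨A, hA, hB⟩ := h
  by_cases hzA : z ∈ A
  · refine Or.inr (hB.mono fun x hx => ⟨Or.inr hx, fun hxA => ?_⟩)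
    exact hA ⟨Or.inr hx, hxA⟩ ⟨Or.inl rfl, hzA⟩ (hz x hx).ne (hz x hx)
  · refine Or.inl ⟨A, hA.mono (Set.inter_subset_inter_left _ (Set.subset_insert z W)), ?_⟩
    intro x hx y hy hxy
    exact hB x ⟨Or.inr hx.1, hx.2⟩ z ⟨Or.inl rfl, hzA⟩ y ⟨Or.inr hy.1, hy.2⟩ (hz x hx.1)
      (hz y hy.1).symm hxy

/-- The join of `P₃` and two nonadjacent vertices is not monopolar. -/
lemma not_isMonopolarOn_of_wheel (ha : a ∈ U) (hb : b ∈ U) (hc : c ∈ U) (hy : y ∈ U) (hz : z ∈ U)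
    (hab : G.Adj a b) (hbc : G.Adj b c) (hac : Gᶜ.Adj a c) (hyz : Gᶜ.Adj y z)
    (h : ∀ x ∈ ({a, b, c} : Set V), G.Adj x y ∧ G.Adj x z) : ¬G.IsMonopolarOn U := by
  rintro ⟨A, hA, hB⟩
  have key : ∀ {p q}, p ∈ U → q ∈ U → G.Adj p q → p ∉ A ∨ q ∉ A := by
    intro p q hp hq hpq
    by_contra! hc
    exact hA ⟨hp, hc.1⟩ ⟨hq, hc.2⟩ hpq.ne hpq
  have key' : ∀ {p q r}, p ∈ U → q ∈ U → r ∈ U → G.Adj p q → G.Adj q r → Gᶜ.Adj p r →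
      p ∈ A ∨ q ∈ A ∨ r ∈ A := by
    intro p q r hp hq hr hpq hqr hpr
    by_contra! hc
    exact hpr.2 (hB p ⟨hp, hc.1⟩ q ⟨hq, hc.2.1⟩ r ⟨hr, hc.2.2⟩ hpq hqr hpr.ne)
  obtain ⟨hay, haz⟩ := h a (by simp)
  obtain ⟨hby, hbz⟩ := h b (by simp)
  obtain ⟨hcy, hcz⟩ := h c (by simp)
  -- The `P₃` on `a, b, c` must meet `A`, which keeps `y` and `z` out of it. Then the paths `y, a,
  -- z` and `y, b, z` force the adjacent `a` and `b` into `A`.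
  have hnot : ∀ w ∈ U, G.Adj a w → G.Adj b w → G.Adj c w → w ∉ A := by
    intro w hw haw hbw hcw hwA
    rcases key' ha hb hc hab hbc hac with h' | h' | h'
    exacts [(key ha hw haw).elim (· h') (· hwA), (key hb hw hbw).elim (· h') (· hwA),
      (key hc hw hcw).elim (· h') (· hwA)]
  have hyA := hnot y hy hay hby hcy
  have hzA := hnot z hz haz hbz hcz
  have haA := ((key' hy ha hz hay.symm haz hyz).resolve_left hyA).resolve_right hzA
  have hbA := ((key' hy hb hz hby.symm hbz hyz).resolve_left hyA).resolve_right hzA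
  exact (key ha hb hab).elim (· haA) (· hbA)

/-- In a `P₄`-sparse graph, no minimal set that is not monopolar contains a `P₄`. -/
lemma HasSparseP4.isMonopolarOn_of_minimal [Finite V] (hG : G.HasSparseP4) (hP : G.HasP4 U)
    (hmin : ∀ W ⊆ U, W ≠ U → G.IsMonopolarOn W) : G.IsMonopolarOn U := by
  by_cases hs : G.IsSeparated U
  · obtain ⟨P, Q, ⟨p, hp⟩, ⟨q, hq⟩, hdis, rfl, hPQ⟩ := hs
    exact (hmin P Set.subset_union_left fun he =>
      Set.disjoint_right.1 hdis hq (he ▸ Or.inr hq)).union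
      (hmin Q Set.subset_union_right fun he =>
      Set.disjoint_left.1 hdis hp (he ▸ Or.inl hp)) hdis hPQ
  by_cases hs' : Gᶜ.IsSeparated U
  · obtain ⟨P, Q, hPne, hQne, hdis, rfl, hPQ⟩ := hs'
    have main : ∀ P Q : Set V, Q.Nonempty → Disjoint P Q → (∀ x ∈ P, ∀ y ∈ Q, ¬Gᶜ.Adj x y) →
        (∀ W ⊆ P ∪ Q, W ≠ P ∪ Q → G.IsMonopolarOn W) → G.HasP4 P → G.IsMonopolarOn (P ∪ Q) := by
      rintro P Q ⟨z, hz⟩ hdis hPQ hmin hP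
      have hPQ' := adj_of_not_compl_adj hdis hPQ
      refine (isSplitOn_compl.1 (IsSplitOn.union_isIndepSet (IsSplitOn.compl ?_) ?_
        hPQ)).isMonopolarOn
      -- A proper subset of `P` stays proper after adding the dominating `z`, so it is monopolar,
      -- hence split or a cluster.
      · refine hG.isSplitOn_of_minimal hP fun W hW hne =>
          (hmin (insert z W) ?_ fun he => hne ?_).isSplitOn_or_isClusterOn
            fun x hx => hPQ' x (hW hx) z hz
        · rintro x (rfl | hx)
          exacts [Or.inr hz, Or.inl (hW hx)]
        · refine hW.antisymm fun x hx => ?_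
          have hxm : x ∈ insert z W := he ▸ Or.inl hx
          refine hxm.resolve_left ?_
          rintro rfl
          exact Set.disjoint_left.1 hdis hx hz
      · by_contra hQ
        obtain ⟨y, hy, z, hz, hyz⟩ := not_isIndepSet_iff.1 hQ
        obtain ⟨a, ha, b, hb, c, hc, d, hd, h⟩ := hP
        refine not_isMonopolarOn_of_wheel (by simp) (by simp) (by simp) (by simp) (by simp) h.1
          h.2.1 ⟨h.ne.2.1, h.2.2.2.1⟩ hyz ?_ (hmin {a, b, c, y, z}
          (insert_five_subset ha hb hc hy hz) (h.insert_ne hd hy hz hdis))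
        rintro x (rfl | rfl | rfl)
        exacts [⟨hPQ' _ ha _ hy, hPQ' _ ha _ hz⟩, ⟨hPQ' _ hb _ hy, hPQ' _ hb _ hz⟩,
          ⟨hPQ' _ hc _ hy, hPQ' _ hc _ hz⟩]
    rcases hP.compl.of_union hPQ with hP | hP
    · exact main P Q hQne hdis hPQ hmin (hasP4_compl.1 hP)
    · rw [Set.union_comm] at hmin ⊢
      exact main Q P hPne hdis.symm (fun x hx y hy hc => hPQ y hy x hx hc.symm) hmin
        (hasP4_compl.1 hP)
  obtain ⟨S, K, h⟩ := hG.exists_isSpider hP.nontrivial hs hs'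
  exact (h.isSplitOn_of_minimal hmin).isMonopolarOn

/-! ### Connectedness of minimal obstructions and the theorem -/

lemma HasSparseP4.isMonopolarOn_of_isPolarOn [Finite V] {Y : Set V} (hG : G.HasSparseP4)
    (hP : G.HasP4 Set.univ) (hpol : ¬G.IsPolarOn Set.univ)
    (hmin : ∀ S, S ≠ Set.univ → G.IsPolarOn S) (hY : Y.Nonempty) (hdis : Disjoint X Y)
    (hXYU : X ∪ Y = Set.univ) (hXY : ∀ x ∈ X, ∀ y ∈ Y, ¬G.Adj x y) : G.IsMonopolarOn X := by
  by_contra hX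
  have hXpol : G.IsPolarOn X := by
    refine hmin X fun he => ?_
    obtain ⟨y, hy⟩ := hY
    exact Set.disjoint_right.1 hdis hy (he ▸ trivial)
  have hYcl : ¬G.IsClusterOn Y := fun h => hpol (hXYU ▸ hXpol.union_isClusterOn h hXY)
  simp only [IsClusterOn, not_forall] at hYcl
  obtain ⟨p, hp, q, hq, r, hr, hpq, hqr, hne, hpr⟩ := hYcl
  have hsub : ({p, q, r} : Set V) ⊆ Y := by
    rintro x (rfl | rfl | rfl) <;> assumption
  have hcl : ¬G.IsClusterOn {p, q, r} := fun h =>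
    hpr (h p (by simp) q (by simp) r (by simp) hpq hqr hne)
  -- Applied to `X` itself this puts the `P₄` into `X`, since three vertices contain none; applied
  -- to proper subsets it makes `X` minimal non-monopolar.
  have hfull : ∀ W ⊆ X, ¬G.IsMonopolarOn W → W ∪ {p, q, r} = Set.univ := by
    intro W hW hmono
    by_contra hne
    exact not_isPolarOn_of_isClusterOn hmono hcl Set.subset_union_left Set.subset_union_right
      (fun x hx y hy => hXY x (hW hx) y (hsub hy)) (hmin _ hne)
  have hXP : G.HasP4 X := by
    rw [← hfull X subset_rfl hX] at hP
    exact (hP.of_union fun x hx y hy => hXY x hx y (hsub hy)).resolve_right (not_hasP4_triple p q r)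
  refine hX (hG.isMonopolarOn_of_minimal hXP fun W hW hne => ?_)
  by_contra hmono
  refine hne (hW.antisymm fun x hx => ?_)
  have hxm : x ∈ W ∪ {p, q, r} := hfull W hW hmono ▸ trivial
  exact hxm.resolve_right fun h => Set.disjoint_left.1 hdis hx (hsub h)

lemma HasSparseP4.not_isSeparated_univ [Finite V] (hG : G.HasSparseP4) (hP : G.HasP4 Set.univ)
    (hpol : ¬G.IsPolarOn Set.univ) (hmin : ∀ S, S ≠ Set.univ → G.IsPolarOn S) :
    ¬G.IsSeparated Set.univ := by
  rintro ⟨X, Y, hX, hY, hdis, hXYU, hXY⟩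
  have h1 := hG.isMonopolarOn_of_isPolarOn hP hpol hmin hY hdis hXYU hXY
  have h2 := hG.isMonopolarOn_of_isPolarOn hP hpol hmin hX hdis.symm (Set.union_comm X Y ▸ hXYU)
    (fun x hx y hy hc => hXY y hy x hx hc.symm)
  exact hpol (hXYU ▸ (h1.union h2 hdis hXY).isPolarOn)

end SimpleGraph

theorem mainTheorem7 {V : Type u} [Finite V] (G : SimpleGraph V)
    (hsparse : G.IsP4Sparse) (hmin : G.IsMinimalPolarObstruction) : G.IsCograph := by
  obtain ⟨hpol, hmin⟩ := hmin
  have hG := hsparse.hasSparseP4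
  rw [SimpleGraph.isPolar_iff] at hpol
  replace hmin : ∀ S, S ≠ Set.univ → G.IsPolarOn S := fun S hS => (hmin S hS).isPolarOn
  have : Nonempty V := by
    by_contra hV
    rw [not_nonempty_iff] at hV
    exact hpol ⟨∅, fun x => isEmptyElim x, fun x => isEmptyElim x⟩
  by_contra hco
  have hP : G.HasP4 Set.univ := by
    by_contra hP
    exact hco (SimpleGraph.isCograph_of_not_hasP4 hP)
  obtain ⟨S, K, h⟩ := hG.exists_isSpider hP.nontrivial (hG.not_isSeparated_univ hP hpol hmin)
    (hG.compl.not_isSeparated_univ hP.compl (fun hc => hpol (SimpleGraph.isPolarOn_compl.1 hc))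
      fun S hS => (hmin S hS).compl)
  refine hpol (h.isPolarOn (hmin _ fun he => ?_))
  obtain ⟨s, hs⟩ := h.legs_nonempty
  exact (he.ge (Set.mem_univ s)).2 (Or.inl hs)
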